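/- A cover $\mathbf H$ on a set $X$ is given by a family $\mathcal H\subseteq\mathcal P(X)$ and a function $m$ assigning to each $H\in\mathcal H$ a nonzero ordinal $m(H)$, its multiplicity; the members of $\mathbf H$ are the pairs $\langle H,\alpha\rangle$ with $H\in\mathcal H$ and $\alpha<m(H)$, and for $x\in X$ we write $\mathbf H(x)$ for the set of all members $\langle H,\alpha\rangle$ with $x\in H$. For a cardinal $\kappa$, a partial function $c$ from the set of members of $\mathbf H$ to the ordinals is a $\kappa$-good coloring of $\mathbf H$ if for every $x\in\bigcup\mathcal H$ with $|\mathbf H(x)|\ge\kappa$ every ordinal less than $\kappa$ belongs to $c[\mathbf H(x)]$. It is a $[\omega_1,\infty)$-good coloring if it is $\lambda$-good for every cardinal $\lambda\ge\omega_1$. Theorem 7.3. Let $X$ be a hereditarily Lindelöf topological space (every subspace of $X$ is Lindelöf), and let $\mathfrak B\subseteq\mathcal P(X)$ be closed under intersections of two of its members and well-founded under $\subseteq$ (there is no infinite strictly decreasing sequence $B_0\supsetneq B_1\supsetneq\cdots$ in $\mathfrak B$). Let $\mathbf H$ be a cover on $X$, with family $\mathcal H$ and multiplicity function $m$, such that every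 $H\in\mathcal H$ is the union of a countable (finite, possibly empty, or countably infinite) family of sets of the form $B\cap G$ with $B\in\mathfrak B$ and $G$ open in $X$. Then $\mathbf H$ has a $[\omega_1,\infty)$-good coloring. -/

import Mathlib

universe u

/-- A cover on `X`, with multiplicities: a family `sets` of subsets of `X` together with a nonzero
ordinal multiplicity for each member of the family. -/
structure MultiCover (X : Type u) where
  /-- the underlying family of sets -/
  sets : Set (Set X)
  /-- the multiplicity with which each set of the family is used -/
  mult : sets → Ordinal.{u}
  /-- multiplicities are nonzero -/
  mult_ne_zero : ∀ A : sets, mult A ≠ 0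

namespace MultiCover

variable {X : Type u}

/-- The members of the cover: the pairs `⟨A, α⟩` where `A` is a set of the family and `α` is one of
the ordinals below the multiplicity of `A` (`o.ToType` is the well-order of the ordinals
below `o`). -/
def Member (H : MultiCover X) : Type u :=
  Σ A : H.sets, (H.mult A).ToType

/-- The set of the members `⟨A, α⟩` of the cover with `x ∈ A`. -/
def membersAt (H : MultiCover X) (x : X) : Set H.Member :=
  {p | x ∈ (p.1 : Set X)}

/-- The partial colouring `c` of the members of `H` by ordinals is a `κ`-good colouring of `H`
over `Y`: at every point `x` of `Y` which lies in at least `κ` members, all colours `< κ` occur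
among the members that contain `x`. -/
def IsGoodColoringOver (H : MultiCover X) (κ : Cardinal.{u}) (c : H.Member →. Ordinal.{u})
    (Y : Set X) : Prop :=
  ∀ x ∈ Y, κ ≤ Cardinal.mk (H.membersAt x) → Set.Iio κ.ord ⊆ c.image (H.membersAt x)

/-- The partial colouring `c` is a `κ`-good colouring of `H`, that is, over the union of the family
of sets of `H`. -/
def IsGoodColoring (H : MultiCover X) (κ : Cardinal.{u}) (c : H.Member →. Ordinal.{u}) : Prop :=
  H.IsGoodColoringOver κ c (⋃₀ H.sets)

/-- The partial colouring `c` is a `[κ, ∞)`-good colouring of `H`: it is `μ`-good for every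
cardinal `μ ≥ κ`. -/
def IsGoodColoringFrom (H : MultiCover X) (κ : Cardinal.{u}) (c : H.Member →. Ordinal.{u}) : Prop :=
  ∀ μ : Cardinal.{u}, κ ≤ μ → H.IsGoodColoring μ c

end MultiCover

/-- The family of all countable unions of sets of the form `B ∩ G` with `B ∈ 𝔅` and `G` open. -/
def countableAmalgam {X : Type u} [TopologicalSpace X] (𝔅 : Set (Set X)) : Set (Set X) :=
  {S | ∃ 𝒳 : Set (Set X), 𝒳 ⊆ {A | ∃ B ∈ 𝔅, ∃ G : Set X, IsOpen G ∧ A = B ∩ G} ∧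
    𝒳.Countable ∧ S = ⋃₀ 𝒳}

/-!
The colouring is built by transfinite induction, with partial colourings of part of the cover as
approximations. Every `A` in the cover is a union of countably many *pieces* `B ∩ G`, with `B` from
a well-founded family closed under intersections and `G` open. A partial colouring is kept *good*:
every point that lies in more than `max |α| ℵ₀` of the members coloured so far sees the colour `α`.

For a finite set `s` of pieces let `core s` be the intersection of their first components `B`. By
well-foundedness, among the sets `core s` that contain a given point `x` there is a minimal, hence
a least one, and on it every member containing `x` is a relatively open neighbourhood of `x`
(`exists_core_minimal`). So it suffices to *perform* all the tasks `(s, α)`: to let every point of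
`core s` that lies in more than `max |α| ℵ₀` members having it in their relatively open trace on
`core s` see `α`. A single task can be performed in any good colouring `c` (`exists_performs`):
a point which does not yet see `α` lies in at most `max |α| ℵ₀` coloured members, so it lies in the
trace of an uncoloured one; as the space is hereditarily Lindelöf, countably many uncoloured members
serve all these points, and colouring only countably many further members cannot destroy goodness.

For many tasks (`exists_performs_all`) one inducts on their number `κ`. If `κ` is uncountable, one
splits the tasks into a chain of length `κ` of smaller batches, and adds to the `ζ`-th batch all
tasks `(s, α)` with `α < ζ` and `s` a set of pieces of the members coloured during the construction
before stage `ζ`. These additional tasks keep the colouring good at limit stages: if `x` lies in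
more than `max |α| ℵ₀` coloured members only at the limit stage `ζ`, then `α < ζ`, and all members
newly coloured around `x` have `x` in their trace on the least core, a core which already occurs at
an earlier stage; so the task for this core and `α` has been performed.
-/

/-- An indexed family of sets in a space `X`, each of them presented as a countable union of pieces
`base p ∩ nbhd p` with `nbhd p` open, such that the finite intersections of the sets `base p` are
well-founded under strict inclusion. -/
structure PiecewiseOpenFamily (X : Type u) [TopologicalSpace X] where
  /-- the indices of the sets of the family -/
  Index : Type u
  /-- the pieces of all the sets of the family -/
  Piece : Type u
  /-- the index of the set to which a piece belongs -/
  owner : Piece → Index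
  countable_fiber : ∀ i, {p | owner p = i}.Countable
  /-- the first component of a piece -/
  base : Piece → Set X
  /-- the open component of a piece -/
  nbhd : Piece → Set X
  isOpen_nbhd : ∀ p, IsOpen (nbhd p)
  wellFounded : WellFounded fun s t : Finset Piece => (⋂ p ∈ s, base p) ⊂ ⋂ p ∈ t, base p

namespace PiecewiseOpenFamily

open Set Cardinal

variable {X : Type u} [TopologicalSpace X] (D : PiecewiseOpenFamily X)

/-! ### Cores and traces -/

/-- The intersection of the first components of the pieces in `s`; it is the whole space when `s` is
empty. -/
def core (s : Finset D.Piece) : Set X := ⋂ p ∈ s, D.base p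

/-- The set with index `i`. -/
def carrier (i : D.Index) : Set X := {x | ∃ p, D.owner p = i ∧ x ∈ D.base p ∧ x ∈ D.nbhd p}

/-- The relatively open subset of `core s` on which membership in the set with index `i` is
witnessed by a piece whose first component contains all of `core s`. -/
def trace (s : Finset D.Piece) (i : D.Index) : Set X :=
  {x | x ∈ D.core s ∧ ∃ p, D.owner p = i ∧ D.core s ⊆ D.base p ∧ x ∈ D.nbhd p}

lemma trace_subset_carrier (s : Finset D.Piece) (i : D.Index) : D.trace s i ⊆ D.carrier i := by
  rintro x ⟨hx, p, hp, hs, hxp⟩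
  exact ⟨p, hp, hs hx, hxp⟩

/-- Among the cores of the finite sets of pieces owned by members of `M`, each point has a least one
containing it, and there carriers and traces of the members of `M` agree at this point. -/
lemma exists_core_minimal (M : Set D.Index) (x : X) :
    ∃ s : Finset D.Piece, (∀ p ∈ s, D.owner p ∈ M) ∧ x ∈ D.core s ∧
      ∀ i ∈ M, x ∈ D.carrier i → x ∈ D.trace s i := by
  classical
  obtain ⟨s, ⟨hsM, hxs⟩, hmin⟩ := D.wellFounded.has_min
    {s : Finset D.Piece | (∀ p ∈ s, D.owner p ∈ M) ∧ x ∈ D.core s} ⟨∅, by simp [core]⟩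
  refine ⟨s, hsM, hxs, ?_⟩
  rintro i hi ⟨p, rfl, hxp, hxG⟩
  refine ⟨hxs, p, rfl, ?_, hxG⟩
  have hcore : D.core (insert p s) = D.base p ∩ D.core s := by
    simp [core]
  have hnot := hmin (insert p s) ⟨by simpa [hi] using hsM, by rw [hcore]; exact ⟨hxp, hxs⟩⟩
  change ¬ D.core (insert p s) ⊂ D.core s at hnot
  rw [hcore] at hnot
  by_contra hsub
  exact hnot ⟨inter_subset_right, fun h => hsub (h.trans inter_subset_left)⟩

/-! ### Good partial colourings -/

variable {D}

/-- The indices coloured by `c`, a partial colouring being encoded as its graph, so that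
extension of colourings is inclusion and the limit of a chain of colourings is its union. -/
def dom (c : Set (D.Index × Ordinal.{u})) : Set D.Index := Prod.fst '' c

/-- The point `x` lies in a set coloured `α`. -/
def Sees (c : Set (D.Index × Ordinal.{u})) (x : X) (α : Ordinal.{u}) : Prop :=
  ∃ i, (i, α) ∈ c ∧ x ∈ D.carrier i

/-- `c` is (the graph of) a partial colouring, and every point that lies in uncountably many and more
than `|α|` coloured sets sees the colour `α`. -/
structure Good (c : Set (D.Index × Ordinal.{u})) : Prop where
  functional : ∀ i α β, (i, α) ∈ c → (i, β) ∈ c → α = β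
  sees : ∀ x α, max α.card ℵ₀ < #{i | i ∈ dom c ∧ x ∈ D.carrier i} → Sees c x α

/-- The task `t = (s, α)` is performed by `c`: every point that lies in uncountably many and more
than `|α|` traces on `core s`, coloured or not, sees the colour `α`. -/
def Performs (c : Set (D.Index × Ordinal.{u})) (t : Finset D.Piece × Ordinal.{u}) : Prop :=
  ∀ x, max t.2.card ℵ₀ < #{i | x ∈ D.trace t.1 i} → Sees c x t.2

lemma dom_mono {c c' : Set (D.Index × Ordinal.{u})} (h : c ⊆ c') : dom c ⊆ dom c' :=
  image_mono h

lemma Sees.mono {c c' : Set (D.Index × Ordinal.{u})} (h : c ⊆ c') {x : X} {α : Ordinal.{u}} :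
    Sees c x α → Sees c' x α :=
  fun ⟨i, hi, hx⟩ => ⟨i, h hi, hx⟩

lemma Performs.mono {c c' : Set (D.Index × Ordinal.{u})} (h : c ⊆ c')
    {t : Finset D.Piece × Ordinal.{u}} (ht : Performs c t) : Performs c' t :=
  fun x hx => (ht x hx).mono h

lemma lt_mk_of_mk_diff_le {ι : Type u} {κ : Cardinal.{u}} (hκ : ℵ₀ ≤ κ) {A B : Set ι}
    (hA : κ < #A) (h : #(A \ B : Set ι) ≤ κ) : κ < #B := by
  by_contra! hB
  have h1 : #A ≤ #(A \ B : Set ι) + #B :=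
    (mk_le_mk_of_subset (t := A \ B ∪ B) (by simp)).trans (mk_union_le _ _)
  exact absurd (h1.trans (add_le_of_le hκ h hB)) hA.not_ge

lemma Good.of_countable_extension {c c' : Set (D.Index × Ordinal.{u})} (hc : Good c) (h : c ⊆ c')
    (hfun : ∀ i α β, (i, α) ∈ c' → (i, β) ∈ c' → α = β) (hcount : (dom c' \ dom c).Countable) :
    Good c' := by
  refine ⟨hfun, fun x α hx => (hc.sees x α ?_).mono h⟩
  refine lt_mk_of_mk_diff_le (le_max_right _ _) hx (le_trans ?_ (le_max_right _ _))
  refine (mk_le_mk_of_subset ?_).trans hcount.le_aleph0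
  rintro i ⟨⟨hi, hxi⟩, hn⟩
  exact ⟨hi, fun h' => hn ⟨h', hxi⟩⟩

/-- A single task can be performed by colouring countably many further members. -/
lemma exists_performs [HereditarilyLindelofSpace X] {c : Set (D.Index × Ordinal.{u})} (hc : Good c)
    (t : Finset D.Piece × Ordinal.{u}) :
    ∃ c', c ⊆ c' ∧ Good c' ∧ (dom c' \ dom c).Countable ∧ Performs c' t := by
  obtain ⟨s, α⟩ := t
  let W : Set X := {x | max α.card ℵ₀ < #{i | x ∈ D.trace s i} ∧ ¬ Sees c x α}
  let U : {p // D.owner p ∉ dom c ∧ D.core s ⊆ D.base p} → Set X := fun p => D.nbhd p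
  have hWU : W ⊆ ⋃ p, U p := by
    rintro x ⟨hx, hns⟩
    have hle : #{i | i ∈ dom c ∧ x ∈ D.carrier i} ≤ max α.card ℵ₀ :=
      not_lt.1 fun h => hns (hc.sees x α h)
    obtain ⟨i, ⟨hxs, p, rfl, hsub, hxp⟩, hi⟩ :
        ∃ i, x ∈ D.trace s i ∧ i ∉ dom c := by
      by_contra! hall
      refine absurd (hle.trans_lt hx) (not_lt.2 (mk_le_mk_of_subset ?_))
      exact fun i hi => ⟨hall i hi, D.trace_subset_carrier s i hi⟩
    exact mem_iUnion.2 ⟨⟨p, hi, hsub⟩, hxp⟩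
  obtain ⟨r, hr, hWr⟩ := (HereditarilyLindelofSpace.isLindelof W).elim_countable_subcover U
    (fun p => D.isOpen_nbhd p) hWU
  let N : Set D.Index := (fun p => D.owner p.1) '' r
  have hN : N.Countable := hr.image _
  have hNc : ∀ i ∈ N, i ∉ dom c := by
    rintro i ⟨p, -, rfl⟩
    exact p.2.1
  have hsub : c ⊆ c ∪ N ×ˢ {α} := subset_union_left
  have hcount : (dom (c ∪ N ×ˢ {α}) \ dom c).Countable := by
    refine hN.mono ?_
    rintro i ⟨⟨⟨j, β⟩, h | h, rfl⟩, hi⟩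
    · exact absurd ⟨_, h, rfl⟩ hi
    · exact h.1
  refine ⟨c ∪ N ×ˢ {α}, hsub, hc.of_countable_extension hsub ?_ hcount, hcount, ?_⟩
  · rintro i β γ (h | h) (h' | h')
    · exact hc.functional i β γ h h'
    · exact absurd ⟨_, h, rfl⟩ (hNc i h'.1)
    · exact absurd ⟨_, h', rfl⟩ (hNc i h.1)
    · exact h.2.trans h'.2.symm
  · intro x hx
    by_cases hs : Sees c x α
    · exact hs.mono hsub
    obtain ⟨p, hpr, hxp⟩ := mem_iUnion₂.1 (hWr ⟨hx, hs⟩)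
    obtain ⟨i, hi⟩ : ({i | x ∈ D.trace s i}).Nonempty := by
      rw [nonempty_iff_ne_empty]
      intro h0
      change max α.card ℵ₀ < #{i | x ∈ D.trace s i} at hx
      rw [h0] at hx
      simp at hx
    exact ⟨D.owner p.1, Or.inr ⟨⟨p, hpr, rfl⟩, rfl⟩, p.1, rfl, p.2.2 hi.1, hxp⟩

/-! ### Chains of extensions -/

/-- The part of a transfinite chain, starting from `c`, that is built before stage `ζ`. -/
def before {β : Type*} (c : Set β) (F : Ordinal.{u} → Set β) (ζ : Ordinal.{u}) : Set β :=
  c ∪ ⋃ η < ζ, F η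

/-- Transfinite dependent choice: there is a chain of extensions whose every stage satisfies the
requirement `P`, as far as this can be satisfied over what has been built before. -/
lemma exists_chain {β : Type*} (c : Set β) (P : Ordinal.{u} → Set β → Set β → Prop) :
    ∃ F : Ordinal.{u} → Set β, ∀ ζ, before c F ζ ⊆ F ζ ∧
      ((∃ G, before c F ζ ⊆ G ∧ P ζ (before c F ζ) G) → P ζ (before c F ζ) (F ζ)) := by
  classical
  let step : Ordinal.{u} → Set β → Set β := fun ζ G =>
    if h : ∃ G', G ⊆ G' ∧ P ζ G G' then h.choose else G
  let F : Ordinal.{u} → Set β := WellFoundedLT.fix (motive := fun _ => Set β)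
    fun ζ f => step ζ (c ∪ ⋃ (η : Ordinal.{u}) (h : η < ζ), f η h)
  have hF : ∀ ζ, F ζ = step ζ (before c F ζ) := fun ζ => WellFoundedLT.fix_eq _ _
  refine ⟨F, fun ζ => ⟨?_, fun h => ?_⟩⟩
  · rw [hF]
    by_cases h : ∃ G', before c F ζ ⊆ G' ∧ P ζ (before c F ζ) G'
    · simpa only [step, dif_pos h] using h.choose_spec.1
    · simp only [step, dif_neg h, subset_rfl]
  · rw [hF ζ]
    simpa only [step, dif_pos h] using h.choose_spec.2

section Chain

variable {c : Set (D.Index × Ordinal.{u})} {F : Ordinal.{u} → Set (D.Index × Ordinal.{u})}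

lemma subset_before (ζ : Ordinal.{u}) : c ⊆ before c F ζ := subset_union_left

lemma subset_before_of_lt {η ζ : Ordinal.{u}} (h : η < ζ) : F η ⊆ before c F ζ :=
  fun _ hz => Or.inr (mem_iUnion₂.2 ⟨η, h, hz⟩)

lemma chain_mono (hF : ∀ ζ, before c F ζ ⊆ F ζ) {η ζ : Ordinal.{u}} (h : η ≤ ζ) : F η ⊆ F ζ := by
  rcases h.eq_or_lt with rfl | h
  · exact subset_rfl
  · exact (subset_before_of_lt h).trans (hF ζ)

lemma mem_dom_before {ζ : Ordinal.{u}} {i : D.Index} :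
    i ∈ dom (before c F ζ) ↔ i ∈ dom c ∨ ∃ η < ζ, i ∈ dom (F η) := by
  constructor
  · rintro ⟨z, hz | hz, rfl⟩
    · exact Or.inl ⟨z, hz, rfl⟩
    · obtain ⟨η, h, hz⟩ := mem_iUnion₂.1 hz
      exact Or.inr ⟨η, h, z, hz, rfl⟩
  · rintro (h | ⟨η, h, hi⟩)
    · exact dom_mono (subset_before ζ) h
    · exact dom_mono (subset_before_of_lt h) hi

lemma functional_before (hc : Good c) (hF : ∀ ζ, before c F ζ ⊆ F ζ) {ζ : Ordinal.{u}}
    (hgood : ∀ η < ζ, Good (F η)) (i : D.Index) (α β : Ordinal.{u})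
    (hα : (i, α) ∈ before c F ζ) (hβ : (i, β) ∈ before c F ζ) : α = β := by
  have key : ∀ z ∈ before c F ζ, z ∈ c ∨ ∃ η < ζ, z ∈ F η := by
    rintro z (hz | hz)
    · exact Or.inl hz
    · simpa using Or.inr (mem_iUnion₂.1 hz)
  have hcF : ∀ η, c ⊆ F η := fun η => (subset_before η).trans (hF η)
  rcases key _ hα with h | ⟨η, hη, h⟩ <;> rcases key _ hβ with h' | ⟨θ, hθ, h'⟩
  · exact hc.functional i α β h h'
  · exact (hgood θ hθ).functional i α β (hcF θ h) h'
  · exact (hgood η hη).functional i α β h (hcF η h')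
  · have hm : max η θ < ζ := max_lt hη hθ
    exact (hgood _ hm).functional i α β (chain_mono hF (le_max_left _ _) h)
      (chain_mono hF (le_max_right _ _) h')

lemma mk_dom_before_diff_le {ζ : Ordinal.{u}} {κ : Cardinal.{u}} (hζ : ζ.card ≤ κ) (hκ : ℵ₀ ≤ κ)
    (h : ∀ η < ζ, #(dom (F η) \ dom c : Set D.Index) ≤ κ) :
    #(dom (before c F ζ) \ dom c : Set D.Index) ≤ κ := by
  refine (mk_le_mk_of_subset ?_).trans
    (mk_biUnion_le_of_le hζ hκ (fun η => dom (F η) \ dom c) h)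
  rintro i ⟨hi, hn⟩
  obtain h | ⟨η, hη, hi⟩ := mem_dom_before.1 hi
  · exact absurd h hn
  · exact mem_iUnion₂.2 ⟨η, hη, hi, hn⟩

lemma mk_diff_le_of_mk_diff_le {ι : Type u} {κ : Cardinal.{u}} (hκ : ℵ₀ ≤ κ) {A B C : Set ι}
    (h : #(A \ B : Set ι) ≤ κ) (h' : #(B \ C : Set ι) ≤ κ) : #(A \ C : Set ι) ≤ κ := by
  refine (mk_le_mk_of_subset (t := A \ B ∪ B \ C) ?_).trans
    ((mk_union_le _ _).trans (add_le_of_le hκ h h'))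
  rintro i ⟨hA, hC⟩
  by_cases hB : i ∈ B
  · exact Or.inr ⟨hB, hC⟩
  · exact Or.inl ⟨hA, hB⟩

/-- Goodness is preserved at a stage `ζ` of a chain in which at most `max |ζ| ℵ₀` members are coloured
before that stage, provided that the tasks given by the members newly coloured before a stage `η`
and by the colours below `η` are performed at stage `η`. -/
lemma good_before (hc : Good c) (hF : ∀ ζ, before c F ζ ⊆ F ζ) {ζ : Ordinal.{u}}
    (hgood : ∀ η < ζ, Good (F η))
    (hcard : #(dom (before c F ζ) \ dom c : Set D.Index) ≤ max ζ.card ℵ₀)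
    (hperf : ∀ η < ζ, ∀ s : Finset D.Piece, (∀ p ∈ s, D.owner p ∈ dom (before c F η) \ dom c) →
      ∀ α < η, Performs (F η) (s, α)) :
    Good (before c F ζ) := by
  refine ⟨functional_before hc hF hgood, fun x α hx => ?_⟩
  by_contra hns
  have hκ : ℵ₀ ≤ max α.card ℵ₀ := le_max_right _ _
  have hcle : #{i | i ∈ dom c ∧ x ∈ D.carrier i} ≤ max α.card ℵ₀ :=
    not_lt.1 fun h => hns ((hc.sees x α h).mono (subset_before ζ))
  have hnew : max α.card ℵ₀ < #{i | i ∈ dom (before c F ζ) \ dom c ∧ x ∈ D.carrier i} := by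
    refine lt_mk_of_mk_diff_le hκ hx ((mk_le_mk_of_subset ?_).trans hcle)
    rintro i ⟨⟨hi, hxi⟩, hn⟩
    refine ⟨?_, hxi⟩
    by_contra hic
    exact hn ⟨⟨hi, hic⟩, hxi⟩
  have hαζ : α < ζ := by
    by_contra! hle
    refine absurd (hnew.trans_le ?_) (lt_irrefl _)
    refine (mk_le_mk_of_subset fun i hi => hi.1).trans (hcard.trans ?_)
    exact max_le_max_right _ (Ordinal.card_le_card hle)
  obtain ⟨s, hs, -, htrace⟩ := D.exists_core_minimal (dom (before c F ζ) \ dom c) x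
  -- The finite set `s` and the colour `α` occur at some stage `η < ζ` already.
  obtain ⟨η, hη, hαη, hsη⟩ : ∃ η < ζ, α ≤ η ∧ ∀ p ∈ s, D.owner p ∈ dom (F η) \ dom c := by
    classical
    clear htrace
    induction s using Finset.induction_on with
    | empty => exact ⟨α, hαζ, le_rfl, by simp⟩
    | insert p s _ ih =>
      obtain ⟨η, hη, hαη, h⟩ := ih fun q hq => hs q (Finset.mem_insert_of_mem hq)
      obtain ⟨hp, hpc⟩ := hs p (Finset.mem_insert_self p s)
      obtain hp | ⟨θ, hθ, hp⟩ := mem_dom_before.1 hp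
      · exact absurd hp hpc
      refine ⟨max η θ, max_lt hη hθ, hαη.trans (le_max_left _ _), fun q hq => ?_⟩
      rcases Finset.mem_insert.1 hq with rfl | hq
      · exact ⟨dom_mono (chain_mono hF (le_max_right _ _)) hp, hpc⟩
      · exact ⟨dom_mono (chain_mono hF (le_max_left _ _)) (h q hq).1, (h q hq).2⟩
  rcases (Order.succ_le_of_lt hη).eq_or_lt with rfl | hlt
  · -- If `ζ` is the successor of `η`, nothing has been coloured between `F η` and stage `ζ`.
    refine hns (((hgood η hη).sees x α (hx.trans_le (mk_le_mk_of_subset ?_))).mono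
      (subset_before_of_lt hη))
    rintro i ⟨hi, hxi⟩
    refine ⟨?_, hxi⟩
    obtain hi | ⟨θ, hθ, hi⟩ := mem_dom_before.1 hi
    · exact dom_mono ((subset_before η).trans (hF η)) hi
    · exact dom_mono (chain_mono hF (Order.lt_succ_iff.1 hθ)) hi
  · refine hns ((hperf _ hlt s (fun p hp => ⟨?_, (hsη p hp).2⟩) α (Order.lt_succ_iff.2 hαη) x
      (hnew.trans_le (mk_le_mk_of_subset ?_))).mono (subset_before_of_lt hlt))
    · exact dom_mono (subset_before_of_lt (Order.lt_succ η)) (hsη p hp).1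
    · exact fun i hi => htrace i hi.1 hi.2

end Chain

/-! ### Performing all tasks -/

lemma exists_enumeration {J : Type u} {κ : Cardinal.{u}} (hJ : #J ≤ κ) :
    ∃ e : J → Ordinal.{u}, Function.Injective e ∧ ∀ j, e j < κ.ord := by
  rw [← mk_ord_toType κ] at hJ
  obtain ⟨f⟩ := hJ
  refine ⟨fun j => (f j).toOrd, fun j j' h => ?_, fun j => (f j).toOrd.2⟩
  exact f.injective (Ordinal.ToType.mk.symm.injective (Subtype.ext h))

lemma exists_performs_countable [HereditarilyLindelofSpace X] {J : Type u} (hJ : #J ≤ ℵ₀)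
    (t : J → Finset D.Piece × Ordinal.{u}) {c : Set (D.Index × Ordinal.{u})} (hc : Good c) :
    ∃ c', c ⊆ c' ∧ Good c' ∧ #(dom c' \ dom c : Set D.Index) ≤ ℵ₀ ∧ ∀ j, Performs c' (t j) := by
  obtain ⟨e, he, heω⟩ := exists_enumeration hJ
  obtain ⟨F, hF⟩ := exists_chain c fun ζ G G' =>
    Good G' ∧ (dom G' \ dom G).Countable ∧ ∀ j, e j = ζ → Performs G' (t j)
  have hmono := fun ζ => (hF ζ).1
  have hbefore : ∀ ζ ≤ (ℵ₀).ord, (∀ η < ζ, Good (F η) ∧ #(dom (F η) \ dom c : Set D.Index) ≤ ℵ₀) →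
      Good (before c F ζ) ∧ #(dom (before c F ζ) \ dom c : Set D.Index) ≤ ℵ₀ := by
    intro ζ hζ h
    have hcount := mk_dom_before_diff_le (c := c) (F := F)
      (by simpa using Ordinal.card_le_card hζ) le_rfl fun η hη => (h η hη).2
    exact ⟨hc.of_countable_extension (subset_before ζ)
      (functional_before hc hmono fun η hη => (h η hη).1) (le_aleph0_iff_set_countable.1 hcount),
      hcount⟩
  have hstep : ∀ ζ, Good (before c F ζ) →
      Good (F ζ) ∧ (dom (F ζ) \ dom (before c F ζ)).Countable ∧
        ∀ j, e j = ζ → Performs (F ζ) (t j) := by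
    intro ζ h
    refine (hF ζ).2 ?_
    by_cases hj : ∃ j, e j = ζ
    · obtain ⟨j, rfl⟩ := hj
      obtain ⟨c', h1, h2, h3, h4⟩ := exists_performs h (t j)
      exact ⟨c', h1, h2, h3, fun j' hj' => he hj' ▸ h4⟩
    · exact ⟨_, subset_rfl, h, by simp, fun j h' => absurd ⟨j, h'⟩ hj⟩
  have hall : ∀ ζ < (ℵ₀).ord, Good (F ζ) ∧ #(dom (F ζ) \ dom c : Set D.Index) ≤ ℵ₀ := by
    intro ζ
    induction ζ using WellFoundedLT.induction with
    | ind ζ ih =>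
      intro hζ
      obtain ⟨h1, h2⟩ := hbefore ζ hζ.le fun η hη => ih η hη (hη.trans hζ)
      obtain ⟨h3, h4, -⟩ := hstep ζ h1
      exact ⟨h3, mk_diff_le_of_mk_diff_le le_rfl h4.le_aleph0 h2⟩
  obtain ⟨h1, h2⟩ := hbefore _ le_rfl hall
  refine ⟨_, subset_before _, h1, h2, fun j => ?_⟩
  have hg := (hbefore _ (heω j).le fun η hη => hall η (hη.trans (heω j))).1
  exact ((hstep _ hg).2.2 j rfl).mono (subset_before_of_lt (heω j))

lemma mk_finset_pieces_le {κ : Cardinal.{u}} (hκ : ℵ₀ ≤ κ) {M : Set D.Index} (hM : #M ≤ κ) :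
    #(Finset {p : D.Piece // D.owner p ∈ M}) ≤ κ := by
  have hP : #{p : D.Piece // D.owner p ∈ M} ≤ κ := by
    have h1 : {p : D.Piece | D.owner p ∈ M} ⊆ ⋃ i : M, {p | D.owner p = i.1} :=
      fun p hp => mem_iUnion.2 ⟨⟨_, hp⟩, rfl⟩
    refine (mk_le_mk_of_subset h1).trans ((mk_iUnion_le _).trans ?_)
    exact mul_le_of_le hκ hM
      ((ciSup_le' fun i : M => (D.countable_fiber i.1).le_aleph0).trans hκ)
  classical
  rcases finite_or_infinite {p : D.Piece // D.owner p ∈ M} with h | h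
  · exact (mk_le_aleph0 (α := Finset {p : D.Piece // D.owner p ∈ M})).trans hκ
  · rwa [mk_finset_of_infinite]

/-- Any number `κ` of tasks can be performed by colouring at most `κ` further members. -/
lemma exists_performs_all [HereditarilyLindelofSpace X] {κ : Cardinal.{u}} (hκ : ℵ₀ ≤ κ) :
    ∀ {J : Type u}, #J ≤ κ → ∀ (t : J → Finset D.Piece × Ordinal.{u})
      {c : Set (D.Index × Ordinal.{u})}, Good c →
      ∃ c', c ⊆ c' ∧ Good c' ∧ #(dom c' \ dom c : Set D.Index) ≤ κ ∧ ∀ j, Performs c' (t j) := by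
  classical
  induction κ using WellFoundedLT.induction with
  | ind κ ih =>
  intro J hJ t c hc
  rcases hκ.eq_or_lt with rfl | hκ'
  · exact exists_performs_countable hJ t hc
  obtain ⟨e, he, heκ⟩ := exists_enumeration hJ
  obtain ⟨F, hF⟩ := exists_chain c fun ζ G G' =>
    Good G' ∧ #(dom G' \ dom G : Set D.Index) ≤ max ζ.card ℵ₀ ∧
      (∀ j, e j < ζ → Performs G' (t j)) ∧
      ∀ s : Finset D.Piece, (∀ p ∈ s, D.owner p ∈ dom G \ dom c) → ∀ α < ζ, Performs G' (s, α)
  have hmono := fun ζ => (hF ζ).1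
  have hstep : ∀ ζ < κ.ord, Good (before c F ζ) →
      #(dom (before c F ζ) \ dom c : Set D.Index) ≤ max ζ.card ℵ₀ →
      Good (F ζ) ∧ #(dom (F ζ) \ dom (before c F ζ) : Set D.Index) ≤ max ζ.card ℵ₀ ∧
      (∀ j, e j < ζ → Performs (F ζ) (t j)) ∧
      ∀ s : Finset D.Piece, (∀ p ∈ s, D.owner p ∈ dom (before c F ζ) \ dom c) → ∀ α < ζ,
        Performs (F ζ) (s, α) := by
    intro ζ hζ hg hM
    refine (hF ζ).2 ?_
    have hω : ℵ₀ ≤ max ζ.card ℵ₀ := le_max_right _ _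
    have hJζ : #{j // e j < ζ} ≤ max ζ.card ℵ₀ := by
      refine le_trans ?_ (le_max_left _ _)
      rw [← mk_toType]
      refine mk_le_of_injective (f := fun j => Ordinal.ToType.mk ⟨e j.1, j.2⟩) fun j j' h => ?_
      exact Subtype.ext (he (Subtype.ext_iff.1 (Ordinal.ToType.mk.injective h)))
    have hS := mk_finset_pieces_le hω hM
    have hT : #({j // e j < ζ} ⊕
        Finset {p : D.Piece // D.owner p ∈ dom (before c F ζ) \ dom c} × ζ.ToType) ≤
        max ζ.card ℵ₀ := by
      rw [mk_sum, lift_id, lift_id, mk_prod, lift_id, lift_id, mk_toType]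
      exact add_le_of_le hω hJζ (mul_le_of_le hω hS (le_max_left _ _))
    obtain ⟨c', h1, h2, h3, h4⟩ := ih (max ζ.card ℵ₀) (max_lt (lt_ord.1 hζ) hκ') hω hT
      (Sum.elim (fun j => t j.1) fun q => (q.1.map (Function.Embedding.subtype _), q.2.toOrd.1)) hg
    refine ⟨c', h1, h2, h3, fun j hj => h4 (Sum.inl ⟨j, hj⟩), fun s hs α hα => ?_⟩
    have h5 := h4 (Sum.inr (s.subtype _, Ordinal.ToType.mk ⟨α, hα⟩))
    simpa [Finset.subtype_map_of_mem hs, Ordinal.ToType.toOrd] using h5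
  have hbefore : ∀ ζ, (∀ η < ζ, η < κ.ord → Good (F η) ∧
        #(dom (F η) \ dom c : Set D.Index) ≤ max η.card ℵ₀ ∧
        ∀ s : Finset D.Piece, (∀ p ∈ s, D.owner p ∈ dom (before c F η) \ dom c) →
          ∀ α < η, Performs (F η) (s, α)) → ζ ≤ κ.ord →
      Good (before c F ζ) ∧ #(dom (before c F ζ) \ dom c : Set D.Index) ≤ max ζ.card ℵ₀ := by
    intro ζ h hζ
    have h' := fun η (hη : η < ζ) => h η hη (hη.trans_le hζ)
    have hcard := mk_dom_before_diff_le (c := c) (F := F) (le_max_left ζ.card ℵ₀)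
      (le_max_right _ _) fun η hη =>
        (h' η hη).2.1.trans (max_le_max_right _ (Ordinal.card_le_card hη.le))
    exact ⟨good_before hc hmono (fun η hη => (h' η hη).1) hcard fun η hη => (h' η hη).2.2, hcard⟩
  have hall : ∀ ζ, ζ < κ.ord → Good (F ζ) ∧
      #(dom (F ζ) \ dom c : Set D.Index) ≤ max ζ.card ℵ₀ ∧
      ∀ s : Finset D.Piece, (∀ p ∈ s, D.owner p ∈ dom (before c F ζ) \ dom c) →
        ∀ α < ζ, Performs (F ζ) (s, α) := by
    intro ζ
    induction ζ using WellFoundedLT.induction with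
    | ind ζ ih' =>
      intro hζ
      obtain ⟨h1, h2⟩ := hbefore ζ ih' hζ.le
      obtain ⟨h3, h4, -, h5⟩ := hstep ζ hζ h1 h2
      exact ⟨h3, mk_diff_le_of_mk_diff_le (le_max_right _ _) h4 h2, h5⟩
  obtain ⟨h1, h2⟩ := hbefore κ.ord (fun η _ => hall η) le_rfl
  refine ⟨_, subset_before _, h1, by simpa [hκ] using h2, fun j => ?_⟩
  have hlim : Order.succ (e j) < κ.ord := (isSuccLimit_ord hκ).succ_lt (heκ j)
  obtain ⟨h3, h4⟩ := hbefore (Order.succ (e j)) (fun η _ => hall η) hlim.le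
  exact ((hstep _ hlim h3 h4).2.2.1 j (Order.lt_succ _)).mono (subset_before_of_lt hlim)

/-- There is a colouring under which every point that lies in uncountably many and more than `|α|`
sets of the family, coloured or not, sees the colour `α`. -/
lemma exists_coloring [HereditarilyLindelofSpace X] (D : PiecewiseOpenFamily X) :
    ∃ c : Set (D.Index × Ordinal.{u}), (∀ i α β, (i, α) ∈ c → (i, β) ∈ c → α = β) ∧
      ∀ x α, max α.card ℵ₀ < #{i | x ∈ D.carrier i} → Sees c x α := by
  have hempty : Good (∅ : Set (D.Index × Ordinal.{u})) :=
    ⟨by simp, fun x α hx => by simp [dom] at hx⟩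
  obtain ⟨c, -, hc, -, hperf⟩ := exists_performs_all
    (κ := max #(Finset D.Piece × (#D.Index).ord.ToType) ℵ₀) (le_max_right _ _) (le_max_left _ _)
    (fun q => (q.1, q.2.toOrd.1)) hempty
  refine ⟨c, hc.functional, fun x α hx => ?_⟩
  have hα : α < (#D.Index).ord :=
    lt_ord.2 ((le_max_left _ _).trans_lt (hx.trans_le (mk_set_le _)))
  obtain ⟨s, -, -, hs⟩ := D.exists_core_minimal univ x
  have h := hperf (s, Ordinal.ToType.mk ⟨α, hα⟩)
  simp only [Ordinal.ToType.toOrd, OrderIso.symm_apply_apply] at h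
  exact h x (hx.trans_le (mk_le_mk_of_subset fun i hi => hs i (mem_univ i) hi))

end PiecewiseOpenFamily

theorem theorem7p3 {X : Type u} [TopologicalSpace X] [HereditarilyLindelofSpace X]
    (𝔅 : Set (Set X)) (h_inter : ∀ A ∈ 𝔅, ∀ B ∈ 𝔅, A ∩ B ∈ 𝔅)
    (h_wf : 𝔅.WellFoundedOn (· ⊂ ·))
    (H : MultiCover X) (hH : H.sets ⊆ countableAmalgam 𝔅) :
    ∃ c : H.Member →. Ordinal.{u}, H.IsGoodColoringFrom (Cardinal.aleph 1) c := by
  classical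
  choose 𝒳 h𝒳 hcount hunion using fun A : H.sets => hH A.2
  choose B hB G hG hBG using fun q : Σ A : H.sets, 𝒳 A => h𝒳 q.1 q.2.2
  let base : (Σ i : H.Member, 𝒳 i.1) → Set X := fun p => B ⟨p.1.1, p.2⟩
  -- The intersection of the empty set of pieces is the whole space, which need not belong to `𝔅`.
  have hmem : ∀ s : Finset (Σ i : H.Member, 𝒳 i.1), (⋂ p ∈ s, base p) ∈ insert Set.univ 𝔅 := by
    intro s
    induction s using Finset.induction_on with
    | empty => simp
    | insert p s _ ih =>
      rw [Finset.set_biInter_insert]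
      rcases ih with ih | ih
      · rw [ih, Set.inter_univ]
        exact Or.inr (hB _)
      · exact Or.inr (h_inter _ (hB _) _ ih)
  have hwf : WellFounded fun s t : Finset (Σ i : H.Member, 𝒳 i.1) =>
      (⋂ p ∈ s, base p) ⊂ ⋂ p ∈ t, base p := by
    have h := h_wf.insert Set.univ
    exact InvImage.wf (fun s => (⟨_, hmem s⟩ : (insert Set.univ 𝔅 : Set (Set X)))) h
  let D : PiecewiseOpenFamily X :=
    { Index := H.Member
      Piece := Σ i : H.Member, 𝒳 i.1
      owner := Sigma.fst
      countable_fiber := fun i => by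
        have := (hcount i.1).to_subtype
        refine (Set.countable_range fun q : 𝒳 i.1 => (⟨i, q⟩ : Σ i : H.Member, 𝒳 i.1)).mono ?_
        rintro ⟨j, q⟩ rfl
        exact ⟨q, rfl⟩
      base := base
      nbhd := fun p => G ⟨p.1.1, p.2⟩
      isOpen_nbhd := fun p => hG _
      wellFounded := hwf }
  have hcarrier : ∀ (i : H.Member) (x : X), x ∈ D.carrier i ↔ x ∈ (i.1 : Set X) := by
    intro i x
    rw [hunion i.1]
    constructor
    · rintro ⟨⟨j, q⟩, rfl, hxB, hxG⟩
      exact ⟨q, q.2, by rw [hBG ⟨j.1, q⟩]; exact ⟨hxB, hxG⟩⟩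
    · rintro ⟨A, hA, hx⟩
      have hx' : x ∈ B ⟨i.1, A, hA⟩ ∩ G ⟨i.1, A, hA⟩ := hBG ⟨i.1, A, hA⟩ ▸ hx
      exact ⟨⟨i, A, hA⟩, rfl, hx'.1, hx'.2⟩
  obtain ⟨c, hfun, hc⟩ := D.exists_coloring
  refine ⟨fun i => ⟨∃ α, (i, α) ∈ c, Exists.choose⟩, fun κ hκ x _ hx α hα => ?_⟩
  have hset : {i | x ∈ D.carrier i} = H.membersAt x := Set.ext fun i => hcarrier i x
  have hlt : max α.card Cardinal.aleph0 < Cardinal.mk {i | x ∈ D.carrier i} := by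
    rw [hset]
    refine (max_lt (Cardinal.lt_ord.1 hα) ?_).trans_le hx
    exact Cardinal.aleph0_lt_aleph_one.trans_le hκ
  obtain ⟨i, hi, hxi⟩ := hc x α hlt
  have hex : ∃ α, (i, α) ∈ c := ⟨α, hi⟩
  exact ⟨i, (hcarrier i x).1 hxi, hex, hfun i _ _ hex.choose_spec hi⟩
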